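/- Let $\mathbb{F}\in\{\mathbb{R},\mathbb{C},\mathbb{H}\}$, $m=\dim_{\mathbb{R}}\mathbb{F}\in\{1,2,4\}$, and let $d,n,t\ge 1$ be integers. On the right $\mathbb{F}$-vector space $\mathbb{F}^d$ let $\langle x,y\rangle=\sum_a\overline{x_a}\,y_a$, let $\mathbb{S}$ be the unit sphere of $\mathbb{F}^d=\mathbb{R}^{md}$ and $\sigma$ the surface area measure on $\mathbb{S}$ normalised by $\sigma(\mathbb{S})=1$. The angle between the lines (points of $\mathbb{F}P^{d-1}$) spanned by unit vectors $x,y$ is the number $|\langle x,y\rangle|^2\in[0,1]$. Let $\mu$ be the probability measure on $[0,1]$ that is the image of $\sigma\times\sigma$ under $(x,y)\mapsto|\langle x,y\rangle|^2$. A real polynomial $Q$ of degree exactly $k$ is called an orthogonal polynomial of degree $k$ for $\mu$ if $\int Qp\,d\mu=0$ for all real polynomials $p$ of degree less than $k$. Let $v_1,\dots,v_n\in\mathbb{S}$ represent $n$ different points of $\mathbb{F}P^{d-1}$. - They form a *projective $t$-design* if $\sum_{i=1}^n\sum_{j=1}^n Q(|\langle v_i,v_j\rangle|^2)=0$ for every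 orthogonal polynomial $Q$ for $\mu$ of degree $k$, $k=1,\dots,t$. - They form a *regular scheme* with angles $\{\alpha_1,\dots,\alpha_s\}=\{|\langle v_i,v_j\rangle|^2: i\ne j\}$ and valencies $d_{\alpha_1},\dots,d_{\alpha_s}$ if for every $\ell$ and every $i$ the number of $j\neq i$ with $|\langle v_i,v_j\rangle|^2=\alpha_\ell$ is $d_{\alpha_\ell}$ (independently of $i$). **Theorem.** A regular scheme of $n\ge1$ points in $\mathbb{F}^d$ with angles $\alpha_1,\dots,\alpha_s$ and valencies $d_{\alpha_1},\dots,d_{\alpha_s}$ is a projective $t$-design if and only if $$1+\sum_{\ell=1}^s\alpha_\ell^t\,d_{\alpha_\ell}=n\,\frac{(\frac m2)_t}{(\frac{md}2)_t},\qquad (a)_t:=a(a+1)\cdots(a+t-1).$$ -/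

import Mathlib

open MeasureTheory Polynomial
open scoped Quaternion

noncomputable section

namespace ProjDesign

/-- The Borel σ-algebra on the quaternions. -/
instance instMeasurableSpaceQuaternion : MeasurableSpace ℍ[ℝ] := borel ℍ[ℝ]

instance instBorelSpaceQuaternion : BorelSpace ℍ[ℝ] := ⟨rfl⟩

/-- The space `𝕜 ^ d` of column vectors, with the Euclidean norm
`‖x‖ = (∑ a, |x_a| ^ 2) ^ (1/2)`; used for `𝕜 = ℝ, ℂ, ℍ`. -/
abbrev Vec (𝕜 : Type) (d : ℕ) : Type := PiLp 2 (fun _ : Fin d => 𝕜)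

section Generic

variable (𝕜 : Type) [NormedDivisionRing 𝕜] [StarRing 𝕜] [InnerProductSpace ℝ 𝕜]
  [FiniteDimensional ℝ 𝕜] [MeasurableSpace 𝕜] [BorelSpace 𝕜]

variable {𝕜} in
/-- The Euclidean inner product `⟨x, y⟩ = ∑ a, conj x_a * y_a` on `𝕜 ^ d`. -/
def ip {d : ℕ} (x y : Vec 𝕜 d) : 𝕜 := ∑ a, star (x a) * y a

variable {𝕜} in
/-- The angle `|⟨x, y⟩| ^ 2` between the lines spanned by the unit vectors `x` and `y`. -/
def angle {d : ℕ} (x y : Vec 𝕜 d) : ℝ := ‖ip x y‖ ^ 2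

/-- The surface area measure on the unit sphere of `𝕜 ^ d` (regarded as a real Euclidean space),
normalised to total mass one. -/
def sphereMeasure (d : ℕ) : Measure (Metric.sphere (0 : Vec 𝕜 d) 1) :=
  ((volume : Measure (Vec 𝕜 d)).toSphere Set.univ)⁻¹ • (volume : Measure (Vec 𝕜 d)).toSphere

/-- The distribution of the angle `|⟨x, y⟩| ^ 2` of two independent uniformly distributed points
`x, y` of the unit sphere of `𝕜 ^ d`. -/
def angleMeasure (d : ℕ) : Measure ℝ :=
  ((sphereMeasure 𝕜 d).prod (sphereMeasure 𝕜 d)).map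
    (fun p => angle (p.1 : Vec 𝕜 d) (p.2 : Vec 𝕜 d))

/-- `Q` is an orthogonal polynomial of degree `k` for the measure `μ` on the real line. -/
def IsOrthogonalPolynomial (μ : Measure ℝ) (k : ℕ) (Q : ℝ[X]) : Prop :=
  Q.degree = k ∧ ∀ p : ℝ[X], p.degree < k → ∫ s, Q.eval s * p.eval s ∂μ = 0

variable {𝕜}

/-- The points of projective space given by the unit vectors `v_1, …, v_n` form a projective
`t`-design: `∑ i, ∑ j, Q (|⟨v_i, v_j⟩| ^ 2) = 0` for the orthogonal polynomials `Q` of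
degrees `1, …, t` for the distribution of the angle. -/
def IsProjectiveDesign {d n : ℕ} (t : ℕ) (v : Fin n → Vec 𝕜 d) : Prop :=
  ∀ k ∈ Finset.Icc 1 t, ∀ Q : ℝ[X], IsOrthogonalPolynomial (angleMeasure 𝕜 d) k Q →
    ∑ i, ∑ j, Q.eval (angle (v i) (v j)) = 0

open Classical in
/-- The set `{α_1, …, α_s}` of the angles between different members of the family `v`. -/
def angles {d n : ℕ} (v : Fin n → Vec 𝕜 d) : Finset ℝ :=
  (Finset.univ : Finset (Fin n)).offDiag.image (fun p => angle (v p.1) (v p.2))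

open Classical in
/-- The number of the other members of the family `v` that make an angle `α` with `v i`. -/
def valencyAt {d n : ℕ} (v : Fin n → Vec 𝕜 d) (α : ℝ) (i : Fin n) : ℕ :=
  (Finset.univ.filter (fun j : Fin n => j ≠ i ∧ angle (v i) (v j) = α)).card

/-- The unit vectors `v_1, …, v_n` represent `n` different points of projective space (the lines
are those of the right vector space `𝕜 ^ d`) and form a regular scheme with valencies `δ α`:
for every occurring angle `α`, each point makes an angle `α` with exactly `δ α` of the others. -/
structure IsRegularScheme {d n : ℕ} (v : Fin n → Vec 𝕜 d) (δ : ℝ → ℕ) : Prop where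
  norm_eq_one : ∀ i, ‖v i‖ = 1
  lines_ne : ∀ i j, i ≠ j → ¬ ∃ c : 𝕜, ∀ a, v j a = v i a * c
  valency_eq : ∀ α ∈ angles v, ∀ i, valencyAt v α i = δ α

end Generic

end ProjDesign

end

noncomputable section

/-! Put `c_k = (m/2)_k / (md/2)_k`. For a fixed unit vector `v`, `|⟨v, x⟩|²` is the squared length
of the projection of `x` on the real `m`-dimensional line `v𝔽`, so its `k`-th moment over the sphere
is `c_k` (`integral_angle_pow`). Expanding in orthogonal polynomials, a `t`-design is a system with
`∑ᵢⱼ |⟨vᵢ, vⱼ⟩|^(2k) = n² c_k` for all `k ≤ t` (`isProjectiveDesign_iff_sum_pow`).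

The case `k = t` implies the others. The angle is the inner product of the matrices `x x*`, so the
left side minus `n² c_k` is the squared norm of the deviation of the sum of the `k`-th tensor powers
of `vᵢ vᵢ*` from `n` times their mean (`sum_sq_deviation`). As `x x*` has trace 1, contracting one
tensor slot with the trace carries the deviation of degree `k + 1` to that of degree `k`
(`sum_mul_deviation_cons`), so vanishing descends from `t`. For a regular scheme all row sums agree,
and a factor `n` cancels. -/

namespace ProjDesign

/-! ### Gaussian and spherical moments of orthogonal projections. -/

section Moments

variable {E : Type*} [NormedAddCommGroup E] [InnerProductSpace ℝ E] [FiniteDimensional ℝ E]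
  [MeasurableSpace E] [BorelSpace E]

/-- The radial part of a Gaussian moment. -/
lemma integral_radial_gaussian {N : ℕ} (hN : 1 ≤ N) (k : ℕ) :
    ∫ r in Set.Ioi (0 : ℝ), r ^ (N - 1) * (r ^ (2 * k) * Real.exp (-r ^ 2)) =
      1 / 2 * Real.Gamma (N / 2 + k) := by
  have h := integral_rpow_mul_exp_neg_rpow (p := 2) (q := (N - 1 + 2 * k : ℕ)) (by norm_num)
    (by have : (0 : ℝ) ≤ ((N - 1 + 2 * k : ℕ) : ℝ) := by positivity
        linarith)
  have e : (((N - 1 + 2 * k : ℕ) : ℝ) + 1) / 2 = (N : ℝ) / 2 + k := by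
    push_cast [Nat.cast_sub hN]
    ring
  rw [e] at h
  rw [← h]
  refine setIntegral_congr_fun measurableSet_Ioi fun r _ => ?_
  rw [Real.rpow_natCast, ← mul_assoc, ← pow_add]
  norm_num

/-- Polar coordinates for the product of a homogeneous function and a Gaussian. -/
lemma integral_homogeneous_mul_gaussian [Nontrivial E] (k : ℕ) (f : E → ℝ)
    (hf : ∀ (r : ℝ) (x : E), 0 < r → f (r • x) = r ^ (2 * k) * f x) :
    ∫ x : E, f x * Real.exp (-‖x‖ ^ 2) =
      (∫ s : Metric.sphere (0 : E) 1, f s ∂(volume : Measure E).toSphere) *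
        (1 / 2 * Real.Gamma (Module.finrank ℝ E / 2 + k)) := by
  have key := (volume : Measure E).measurePreserving_homeomorphUnitSphereProd.integral_comp
    (Homeomorph.measurableEmbedding _)
    (fun p : Metric.sphere (0 : E) 1 × Set.Ioi (0 : ℝ) =>
      f p.1 * ((p.2 : ℝ) ^ (2 * k) * Real.exp (-(p.2 : ℝ) ^ 2)))
  rw [integral_prod_mul (fun s : Metric.sphere (0 : E) 1 => f s)
    (fun r : Set.Ioi (0 : ℝ) => (r : ℝ) ^ (2 * k) * Real.exp (-(r : ℝ) ^ 2))] at key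
  have hrad : ∫ r : Set.Ioi (0 : ℝ), (r : ℝ) ^ (2 * k) * Real.exp (-(r : ℝ) ^ 2)
      ∂(Measure.volumeIoiPow (Module.finrank ℝ E - 1)) =
      1 / 2 * Real.Gamma (Module.finrank ℝ E / 2 + k) := by
    rw [← integral_radial_gaussian Module.finrank_pos k]
    simp only [Measure.volumeIoiPow, ENNReal.ofReal]
    rw [integral_withDensity_eq_integral_smul
        (measurable_subtype_coe.pow_const _).real_toNNReal,
      integral_subtype_comap measurableSet_Ioi fun a : ℝ =>
        Real.toNNReal (a ^ (Module.finrank ℝ E - 1)) • (a ^ (2 * k) * Real.exp (-a ^ 2))]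
    refine setIntegral_congr_fun measurableSet_Ioi fun x hx => ?_
    rw [NNReal.smul_def, Real.coe_toNNReal _ (pow_nonneg hx.out.le _), smul_eq_mul]
  rw [hrad] at key
  rw [← key]
  calc ∫ x : E, f x * Real.exp (-‖x‖ ^ 2)
      = ∫ x : ({(0 : E)}ᶜ : Set E), f x * Real.exp (-‖(x : E)‖ ^ 2)
          ∂((volume : Measure E).comap (↑)) := by
        rw [integral_subtype_comap (measurableSet_singleton _).compl
          fun x : E => f x * Real.exp (-‖x‖ ^ 2), restrict_compl_singleton]
    _ = _ := by
        refine integral_congr_ae (Filter.Eventually.of_forall fun x => ?_)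
        have hx : 0 < ‖(x : E)‖ := norm_pos_iff.mpr x.2
        simp only [homeomorphUnitSphereProd_apply_snd_coe, homeomorphUnitSphereProd_apply_fst_coe]
        rw [hf _ _ (inv_pos.mpr hx), inv_pow]
        field_simp

/-- Gaussian moments of the orthogonal projection on a subspace. -/
lemma integral_projection_gaussian (K : Submodule ℝ E) [Nontrivial K] :
    ∃ C : ℝ, 0 < C ∧ ∀ k : ℕ,
      ∫ x : E, ‖K.orthogonalProjectionOnto x‖ ^ (2 * k) * Real.exp (-‖x‖ ^ 2) =
        C * Real.Gamma (Module.finrank ℝ K / 2 + k) := by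
  have hB : 0 < ∫ w : Kᗮ, Real.exp (-‖w‖ ^ 2) := by
    have h : Integrable fun w : Kᗮ => Real.exp (-‖w‖ ^ 2) := by
      simpa [Complex.norm_exp, ← Complex.ofReal_pow, -Submodule.coe_norm] using
        (GaussianFourier.integrable_cexp_neg_mul_sq_norm_add
        (V := Kᗮ) (b := 1) (by simp) 0 0).norm
    exact integral_pos_of_integrable_nonneg_nonzero (x := 0) (by fun_prop) h
      (fun _ => (Real.exp_pos _).le) (Real.exp_ne_zero _)
  -- The value of `C` is immaterial; only its independence of `k` is used later.
  refine ⟨(volume : Measure K).toSphere.real Set.univ * (1 / 2) * ∫ w : Kᗮ, Real.exp (-‖w‖ ^ 2),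
    ?_, fun k => ?_⟩
  · have : 0 < (volume : Measure K).toSphere.real Set.univ := by
      rw [measureReal_def]
      refine ENNReal.toReal_pos ?_ (measure_ne_top _ _)
      exact Measure.measure_univ_ne_zero.mpr (Measure.toSphere_ne_zero _)
    positivity
  have hK : ∫ c : K, ‖c‖ ^ (2 * k) * Real.exp (-‖c‖ ^ 2) =
      (volume : Measure K).toSphere.real Set.univ *
        (1 / 2 * Real.Gamma (Module.finrank ℝ K / 2 + k)) := by
    rw [integral_homogeneous_mul_gaussian k (fun c : K => ‖c‖ ^ (2 * k))
      (fun r x hr => by rw [norm_smul, mul_pow, Real.norm_of_nonneg hr.le])]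
    congr 1
    have : ∀ s : Metric.sphere (0 : K) 1, ‖(s : K)‖ ^ (2 * k) = 1 := fun s => by
      rw [norm_eq_of_mem_sphere, one_pow]
    simp only [this, integral_const, smul_eq_mul, mul_one]
  -- The Gaussian factors along `E = K ⊕ Kᗮ`.
  have hmp : MeasurePreserving (fun x : E => WithLp.ofLp (K.orthogonalDecomposition x)) :=
    (WithLp.volume_preserving_ofLp K Kᗮ).comp K.orthogonalDecomposition.measurePreserving
  have hemb : MeasurableEmbedding (fun x : E => WithLp.ofLp (K.orthogonalDecomposition x)) :=
    ((K.orthogonalDecomposition.toHomeomorph.toMeasurableEquiv).trans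
      (MeasurableEquiv.toLp 2 (K × Kᗮ)).symm).measurableEmbedding
  have := hmp.integral_comp hemb (fun p : K × Kᗮ =>
    (‖p.1‖ ^ (2 * k) * Real.exp (-‖p.1‖ ^ 2)) * Real.exp (-‖p.2‖ ^ 2))
  rw [Measure.volume_eq_prod, integral_prod_mul
    (fun c : K => ‖c‖ ^ (2 * k) * Real.exp (-‖c‖ ^ 2))
    (fun w : Kᗮ => Real.exp (-‖w‖ ^ 2)), hK] at this
  calc _ = _ := ?_
    _ = _ := this
    _ = _ := by ring
  refine integral_congr_ae (Filter.Eventually.of_forall fun x => ?_)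
  simp only [Submodule.orthogonalDecomposition_apply]
  rw [mul_assoc, ← Real.exp_add, ← neg_add, ← Submodule.norm_sq_eq_add_norm_sq_projection]

lemma Gamma_add_nat {a : ℝ} (ha : 0 < a) (k : ℕ) :
    Real.Gamma (a + k) = (ascPochhammer ℝ k).eval a * Real.Gamma a := by
  induction k with
  | zero => simp
  | succ k ih =>
    rw [Nat.cast_succ, ← add_assoc, Real.Gamma_add_one (by positivity), ih,
      ascPochhammer_succ_eval]
    ring

/-- Moments of the squared length of the orthogonal projection of a uniformly distributed point
of the sphere. -/
lemma integral_projection_sphere (K : Submodule ℝ E) [Nontrivial K] (k : ℕ) :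
    ∫ s : Metric.sphere (0 : E) 1, ‖K.orthogonalProjectionOnto s‖ ^ (2 * k)
        ∂(volume : Measure E).toSphere =
      (volume : Measure E).toSphere.real Set.univ *
        ((ascPochhammer ℝ k).eval (Module.finrank ℝ K / 2 : ℝ) /
          (ascPochhammer ℝ k).eval (Module.finrank ℝ E / 2 : ℝ)) := by
  have : Nontrivial E := K.subtype_injective.nontrivial
  have hm : 0 < (Module.finrank ℝ K / 2 : ℝ) := by
    have : 0 < Module.finrank ℝ K := Module.finrank_pos
    positivity
  have hN : 0 < (Module.finrank ℝ E / 2 : ℝ) := by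
    have : 0 < Module.finrank ℝ E := Module.finrank_pos
    positivity
  obtain ⟨C, hC, h⟩ := integral_projection_gaussian K
  have hk := h k
  -- The case `k = 0` expresses the total mass through `C`, which eliminates `C`.
  have h0 := h 0
  have hom : ∀ k : ℕ, ∀ (r : ℝ) (x : E), 0 < r → ‖K.orthogonalProjectionOnto (r • x)‖ ^ (2 * k) =
      r ^ (2 * k) * ‖K.orthogonalProjectionOnto x‖ ^ (2 * k) := fun k r x hr => by
    rw [map_smul, norm_smul, mul_pow, Real.norm_of_nonneg hr.le]
  rw [integral_homogeneous_mul_gaussian _ _ (hom _), Gamma_add_nat hm, Gamma_add_nat hN] at hk h0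
  simp only [mul_zero, pow_zero, integral_const, smul_eq_mul, mul_one, ascPochhammer_zero,
    eval_one, one_mul] at h0
  have hp := ascPochhammer_pos k _ hN
  have hG := Real.Gamma_pos_of_pos hN
  rw [← mul_div_assoc, eq_div_iff hp.ne']
  refine mul_right_cancel₀ (mul_ne_zero (one_div_ne_zero two_ne_zero) hG.ne') ?_
  linear_combination hk - (ascPochhammer ℝ k).eval (Module.finrank ℝ K / 2 : ℝ) * h0

end Moments

/-! ### Power sums of a kernel with finitely many features. -/

section Kernel

/-- The monomials are the coordinates of the `t`-th tensor power of the feature vector. -/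
lemma sum_prod_mul_prod {X ι : Type*} [Fintype ι] {φ : X → ι → ℝ} (t : ℕ) (x y : X) :
    ∑ J : Fin t → ι, (∏ k, φ x (J k)) * ∏ k, φ y (J k) = (∑ i, φ x i * φ y i) ^ t := by
  have h := Finset.prod_univ_sum (fun _ : Fin t => (Finset.univ : Finset ι))
    (fun _ i => φ x i * φ y i)
  rw [Finset.prod_const, Finset.card_univ, Fintype.card_fin, Fintype.piFinset_univ] at h
  rw [h]
  simp only [Finset.prod_mul_distrib]

variable {X ι κ : Type*} [MeasurableSpace X] [Fintype ι] [Fintype κ] {σ : Measure X}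
  {φ : X → ι → ℝ} {c : ℕ → ℝ}

/-- The deviation of the empirical mean of the degree `t` monomials in the features `φ` from their
expectation. -/
def deviation (σ : Measure X) (φ : X → ι → ℝ) (v : κ → X) (t : ℕ) (J : Fin t → ι) : ℝ :=
  ∑ i, ∏ k, φ (v i) (J k) - Fintype.card κ * ∫ x, ∏ k, φ x (J k) ∂σ

lemma sum_prod_mul_integral
    (hint : ∀ (t : ℕ) (J : Fin t → ι), Integrable (fun x => ∏ k, φ x (J k)) σ)
    (hc : ∀ x k, ∫ y, (∑ i, φ x i * φ y i) ^ k ∂σ = c k) (t : ℕ) (x : X) :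
    ∑ J : Fin t → ι, (∏ k, φ x (J k)) * ∫ y, ∏ k, φ y (J k) ∂σ = c t := by
  simp only [← hc x t, ← sum_prod_mul_prod, ← integral_const_mul]
  rw [integral_finsetSum _ fun J _ => (hint t J).const_mul _]

/-- By `hc` the kernel mean is the same from every point, so the cross term gives `-2n² c_t` and the
squared mean `+n² c_t`. -/
lemma sum_sq_deviation [IsProbabilityMeasure σ]
    (hint : ∀ (t : ℕ) (J : Fin t → ι), Integrable (fun x => ∏ k, φ x (J k)) σ)
    (hc : ∀ x k, ∫ y, (∑ i, φ x i * φ y i) ^ k ∂σ = c k) (v : κ → X) (t : ℕ) :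
    ∑ J, deviation σ φ v t J ^ 2 =
      ∑ i, ∑ j, (∑ a, φ (v i) a * φ (v j) a) ^ t - (Fintype.card κ : ℝ) ^ 2 * c t := by
  have h1 : ∑ J : Fin t → ι, (∑ i, ∏ k, φ (v i) (J k)) * (∑ i, ∏ k, φ (v i) (J k)) =
      ∑ i, ∑ j, (∑ a, φ (v i) a * φ (v j) a) ^ t := by
    simp only [← sum_prod_mul_prod, Finset.sum_mul_sum]
    rw [Finset.sum_comm]
    exact Finset.sum_congr rfl fun i _ => Finset.sum_comm
  have h2 : ∑ J : Fin t → ι, (∑ i, ∏ k, φ (v i) (J k)) * ∫ y, ∏ k, φ y (J k) ∂σ =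
      Fintype.card κ * c t := by
    simp only [Finset.sum_mul]
    rw [Finset.sum_comm]
    simp [sum_prod_mul_integral hint hc]
  have h3 : ∑ J : Fin t → ι, (∫ y, ∏ k, φ y (J k) ∂σ) * ∫ y, ∏ k, φ y (J k) ∂σ = c t := by
    simp only [← integral_mul_const]
    rw [← integral_finsetSum _ fun J _ => (hint t J).mul_const _]
    simp [sum_prod_mul_integral hint hc]
  calc _ = ∑ J : Fin t → ι, ((∑ i, ∏ k, φ (v i) (J k)) * (∑ i, ∏ k, φ (v i) (J k))
        - 2 * Fintype.card κ * ((∑ i, ∏ k, φ (v i) (J k)) * ∫ y, ∏ k, φ y (J k) ∂σ)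
        + (Fintype.card κ : ℝ) ^ 2 *
          ((∫ y, ∏ k, φ y (J k) ∂σ) * ∫ y, ∏ k, φ y (J k) ∂σ)) :=
      Finset.sum_congr rfl fun J _ => by rw [deviation]; ring
    _ = _ := by
      rw [Finset.sum_add_distrib, Finset.sum_sub_distrib, ← Finset.mul_sum, ← Finset.mul_sum,
        h1, h2, h3]
      ring

/-- The functional `w` is 1 on every feature vector, so contracting the first index with it deletes
that factor. -/
lemma sum_mul_deviation_cons
    (hint : ∀ (t : ℕ) (J : Fin t → ι), Integrable (fun x => ∏ k, φ x (J k)) σ)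
    (w : ι → ℝ) (hw : ∀ x, ∑ i, w i * φ x i = 1) (v : κ → X) (t : ℕ) (J : Fin t → ι) :
    ∑ a, w a * deviation σ φ v (t + 1) (Fin.cons a J) = deviation σ φ v t J := by
  have h : ∀ (x : X), ∑ a, w a * ∏ k, φ x ((Fin.cons a J : Fin (t + 1) → ι) k) =
      ∏ k, φ x (J k) := fun x => by
    simp only [Fin.prod_univ_succ, Fin.cons_zero, Fin.cons_succ, ← mul_assoc]
    rw [← Finset.sum_mul, hw, one_mul]
  simp only [deviation, mul_sub, Finset.sum_sub_distrib, Finset.mul_sum]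
  congr 1
  · rw [Finset.sum_comm]
    simp only [h]
  · simp only [← h]
    rw [integral_finsetSum _ fun a _ => (hint _ _).const_mul _, Finset.mul_sum]
    refine Finset.sum_congr rfl fun a _ => ?_
    rw [integral_const_mul]
    ring

/-- If the degree `t` power sum of a kernel with finitely many features attains its lower bound,
then so do those of smaller degree. -/
lemma sum_kernel_pow_eq_of_le [IsProbabilityMeasure σ]
    (hint : ∀ (t : ℕ) (J : Fin t → ι), Integrable (fun x => ∏ k, φ x (J k)) σ)
    (hc : ∀ x k, ∫ y, (∑ i, φ x i * φ y i) ^ k ∂σ = c k)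
    (w : ι → ℝ) (hw : ∀ x, ∑ i, w i * φ x i = 1) (v : κ → X) {t : ℕ}
    (ht : ∑ i, ∑ j, (∑ a, φ (v i) a * φ (v j) a) ^ t = (Fintype.card κ : ℝ) ^ 2 * c t)
    {k : ℕ} (hk : k ≤ t) :
    ∑ i, ∑ j, (∑ a, φ (v i) a * φ (v j) a) ^ k = (Fintype.card κ : ℝ) ^ 2 * c k := by
  have hdev : ∀ J, deviation σ φ v k J = 0 := by
    induction hk using Nat.decreasingInduction with
    | self =>
      have h := sum_sq_deviation hint hc v t
      rw [ht, sub_self, Finset.sum_eq_zero_iff_of_nonneg fun _ _ => sq_nonneg _] at h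
      exact fun J => pow_eq_zero_iff two_ne_zero |>.mp (h J (Finset.mem_univ _))
    | of_succ k _ ih =>
      intro J
      rw [← sum_mul_deviation_cons hint w hw]
      simp [ih]
  have h := sum_sq_deviation hint hc v k
  simp only [hdev, ne_eq, OfNat.ofNat_ne_zero, not_false_eq_true, zero_pow,
    Finset.sum_const_zero] at h
  linarith

end Kernel

/-! ### Existence of orthogonal polynomials. -/

section OrthogonalPolynomials

variable {μ : Measure ℝ}

/-- Gram–Schmidt in `L²(μ)`. The map `T` need not be injective (for `d = 1` the measure is a point
mass): the degree is read off from a polynomial preimage of the projection. -/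
lemma exists_isOrthogonalPolynomial (hμ : ∀ p : ℝ[X], MemLp (fun s => p.eval s) 2 μ) (k : ℕ) :
    ∃ Q, IsOrthogonalPolynomial μ k Q := by
  let T : ℝ[X] →ₗ[ℝ] Lp ℝ 2 μ :=
    { toFun := fun p => (hμ p).toLp _
      map_add' := fun p q => by
        rw [← MemLp.toLp_add]
        exact MemLp.toLp_congr _ _ (Filter.Eventually.of_forall fun s => eval_add)
      map_smul' := fun r p => by
        rw [RingHom.id_apply, ← MemLp.toLp_const_smul]
        exact MemLp.toLp_congr _ _ (Filter.Eventually.of_forall fun s => eval_smul _ _ _) }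
  have hT : ∀ p q : ℝ[X], inner ℝ (T p) (T q) = ∫ s, q.eval s * p.eval s ∂μ := fun p q => by
    rw [L2.inner_def]
    refine integral_congr_ae ?_
    filter_upwards [(hμ p).coeFn_toLp, (hμ q).coeFn_toLp] with s hp hq
    change inner ℝ ((hμ p).toLp _ s) ((hμ q).toLp _ s) = _
    rw [hp, hq]
    simp
  let W : Submodule ℝ (Lp ℝ 2 μ) := (degreeLT ℝ k).map T
  have : FiniteDimensional ℝ (degreeLT ℝ k) :=
    (degreeLTEquiv ℝ k).symm.finiteDimensional
  have : FiniteDimensional ℝ W := inferInstanceAs (FiniteDimensional ℝ ((degreeLT ℝ k).map T))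
  obtain ⟨q, hq, hqT⟩ := (W.orthogonalProjectionOnto (T (X ^ k))).2
  have hqk : q.degree < k := mem_degreeLT.mp hq
  refine ⟨X ^ k - q, ?_, fun p hp => ?_⟩
  · rw [degree_sub_eq_left_of_degree_lt (by rwa [degree_X_pow]), degree_X_pow]
  · rw [← hT, map_sub, hqT, real_inner_comm]
    have h := W.sub_starProjection_mem_orthogonal (T (X ^ k))
    exact Submodule.inner_left_of_mem_orthogonal
      (Submodule.mem_map_of_mem (mem_degreeLT.mpr hp)) h

end OrthogonalPolynomials

/-! ### Hermitian geometry over the three scalar fields. -/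

/-- The adjoints of the left and right multiplications of `𝕜` by `c` are the multiplications
by `star c`. -/
class InnerStarCompatible (𝕜 : Type) [NormedDivisionRing 𝕜] [StarRing 𝕜]
    [InnerProductSpace ℝ 𝕜] : Prop where
  inner_mul_left : ∀ c a b : 𝕜, inner ℝ (c * a) b = inner ℝ a (star c * b)
  inner_mul_right : ∀ c a b : 𝕜, inner ℝ (a * c) b = inner ℝ a (b * star c)

instance : InnerStarCompatible ℝ where
  inner_mul_left c a b := by simp; ring
  inner_mul_right c a b := by simp; ring

instance : InnerStarCompatible ℂ where
  inner_mul_left c a b := by simp [Complex.inner]; ring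
  inner_mul_right c a b := by simp [Complex.inner]; ring

instance : InnerStarCompatible ℍ[ℝ] where
  inner_mul_left c a b := by simp [Quaternion.inner_def]; ring
  inner_mul_right c a b := by simp [Quaternion.inner_def]; ring

set_option linter.unusedSectionVars false

section Generic

open InnerStarCompatible

variable {𝕜 : Type} [NormedDivisionRing 𝕜] [StarRing 𝕜] [InnerProductSpace ℝ 𝕜]
  [FiniteDimensional ℝ 𝕜] [InnerStarCompatible 𝕜] {d : ℕ}

/-- The coordinates of the matrix `x * star x`. -/
def feature (x : Vec 𝕜 d) (i : Fin d × Fin d × Fin (Module.finrank ℝ 𝕜)) : ℝ :=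
  inner ℝ (x i.1 * star (x i.2.1)) (stdOrthonormalBasis ℝ 𝕜 i.2.2)

lemma continuous_feature [ContinuousStar 𝕜] (i : Fin d × Fin d × Fin (Module.finrank ℝ 𝕜)) :
    Continuous fun x : Vec 𝕜 d => feature x i := by
  unfold feature
  fun_prop

/-- Moving `x a` and `y b` across by their adjoints regroups `⟨x_a x̄_b, y_a ȳ_b⟩` as `⟨x̄_b y_b,
x̄_a y_a⟩`, without commutativity. -/
lemma sum_feature_mul_feature (x y : Vec 𝕜 d) : ∑ i, feature x i * feature y i = angle x y := by
  have h : ∀ a b : Fin d, ∑ k, feature x (a, b, k) * feature y (a, b, k) =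
      inner ℝ (star (x b) * y b) (star (x a) * y a) := fun a b => by
    simp only [feature]
    simp only [real_inner_comm (stdOrthonormalBasis ℝ 𝕜 _) (y a * star (y b)),
      OrthonormalBasis.sum_inner_mul_inner]
    rw [inner_mul_left, ← mul_assoc, ← inner_mul_right]
  rw [Fintype.sum_prod_type]
  simp only [Fintype.sum_prod_type, h]
  simp only [← inner_sum, ← sum_inner]
  rw [angle, ip, real_inner_self_eq_norm_sq]

/-- The functional is the real part of the trace of `x x*`. -/
lemma exists_sum_mul_feature :
    ∃ w : Fin d × Fin d × Fin (Module.finrank ℝ 𝕜) → ℝ,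
      ∀ x : Vec 𝕜 d, ∑ i, w i * feature x i = ‖x‖ ^ 2 := by
  refine ⟨fun i => if i.1 = i.2.1 then inner ℝ (stdOrthonormalBasis ℝ 𝕜 i.2.2) 1 else 0,
    fun x => ?_⟩
  simp only [Fintype.sum_prod_type, ite_mul, zero_mul, PiLp.norm_sq_eq_of_L2]
  refine Finset.sum_congr rfl fun a _ => ?_
  rw [Finset.sum_eq_single a (fun b _ hb => by simp [hb.symm]) (by simp)]
  simp only [if_true, feature, mul_comm (inner ℝ (stdOrthonormalBasis ℝ 𝕜 _) _),
    OrthonormalBasis.sum_inner_mul_inner]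
  rw [← real_inner_self_eq_norm_sq, real_inner_comm, ← inner_mul_right, one_mul]

lemma mul_real_smul (a b : 𝕜) (r : ℝ) : a * (r • b) = r • (a * b) :=
  ext_inner_right ℝ fun e => by
    rw [inner_mul_left, inner_smul_left, inner_smul_left, inner_mul_left]

lemma inner_mul_eq_inner_ip (v x : Vec 𝕜 d) (c : 𝕜) :
    inner ℝ (WithLp.toLp 2 fun a => v a * c : Vec 𝕜 d) x = inner ℝ c (ip v x) := by
  have h : ∀ a, inner ℝ (v a * c) (x a) = inner ℝ c (star (v a) * x a) := fun a =>
    inner_mul_left _ _ _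
  simp only [PiLp.inner_apply, h, ip, inner_sum]

/-- The embedding of `𝕜` onto the line spanned by a unit vector. -/
def lineEmbedding (v : Vec 𝕜 d) (hv : ‖v‖ = 1) : 𝕜 →ₗᵢ[ℝ] Vec 𝕜 d where
  toFun c := WithLp.toLp 2 fun a => v a * c
  map_add' c e := by ext a; exact mul_add _ _ _
  map_smul' r c := by ext a; exact mul_real_smul _ _ _
  norm_map' c := by
    rw [← sq_eq_sq₀ (norm_nonneg _) (norm_nonneg _)]
    have := PiLp.norm_sq_eq_of_L2 (fun _ : Fin d => 𝕜) v
    rw [hv] at this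
    simp [PiLp.norm_sq_eq_of_L2, mul_pow, ← Finset.sum_mul, ← this]

/-- `ip v` is the adjoint of the isometry `lineEmbedding v hv`, hence gives the coordinate of the
projection on its range. -/
lemma norm_projection_line (v : Vec 𝕜 d) (hv : ‖v‖ = 1) (x : Vec 𝕜 d) :
    ‖(lineEmbedding v hv).range.orthogonalProjectionOnto x‖ = ‖ip v x‖ := by
  have h : (lineEmbedding v hv).range.starProjection x = lineEmbedding v hv (ip v x) := by
    refine Submodule.eq_starProjection_of_mem_of_inner_eq_zero ⟨_, rfl⟩ ?_
    rintro _ ⟨c, rfl⟩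
    change inner ℝ (x - lineEmbedding v hv (ip v x)) (lineEmbedding v hv c) = 0
    rw [inner_sub_left, LinearIsometry.inner_map_map, real_inner_comm]
    exact sub_eq_zero.mpr ((inner_mul_eq_inner_ip v x c).trans (real_inner_comm _ _))
  rw [← (lineEmbedding v hv).norm_map (ip v x), ← h]
  rfl

lemma angle_self (v : Vec 𝕜 d) (hv : ‖v‖ = 1) : angle v v = 1 := by
  have h1 : v = lineEmbedding v hv 1 := by
    ext a
    exact (mul_one _).symm
  have h : ip v v = 1 := ext_inner_left ℝ fun c => by
    rw [← inner_mul_eq_inner_ip, ← (lineEmbedding v hv).inner_map_map, ← h1]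
    rfl
  rw [angle, h, norm_one, one_pow]

lemma finrank_vec : Module.finrank ℝ (Vec 𝕜 d) = Module.finrank ℝ 𝕜 * d := by
  rw [(WithLp.linearEquiv 2 ℝ (Fin d → 𝕜)).finrank_eq, Module.finrank_pi_fintype]
  simp [mul_comm]

/-! ### Distribution of the angle and moment criteria for designs. -/

variable [MeasurableSpace 𝕜] [BorelSpace 𝕜]

/-- The moments of the angle with a fixed line. -/
lemma integral_angle_pow (v : Vec 𝕜 d) (hv : ‖v‖ = 1) (k : ℕ) :
    ∫ s, angle v s ^ k ∂(sphereMeasure 𝕜 d) =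
      (ascPochhammer ℝ k).eval (Module.finrank ℝ 𝕜 / 2 : ℝ) /
        (ascPochhammer ℝ k).eval (Module.finrank ℝ 𝕜 * d / 2 : ℝ) := by
  let K := (lineEmbedding v hv).range
  have hK : Module.finrank ℝ K = Module.finrank ℝ 𝕜 :=
    LinearMap.finrank_range_of_inj (lineEmbedding v hv).injective
  have : Nontrivial K := Module.nontrivial_of_finrank_pos (R := ℝ) (hK ▸ Module.finrank_pos)
  have : Nontrivial (Vec 𝕜 d) := K.subtype_injective.nontrivial
  have h := integral_projection_sphere K k
  have hpos : (volume : Measure (Vec 𝕜 d)).toSphere.real Set.univ ≠ 0 := by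
    rw [measureReal_def]
    exact (ENNReal.toReal_pos (Measure.measure_univ_ne_zero.mpr (Measure.toSphere_ne_zero _))
      (measure_ne_top _ _)).ne'
  have hang : ∀ s : Vec 𝕜 d, angle v s ^ k = ‖K.orthogonalProjectionOnto s‖ ^ (2 * k) := fun s => by
    rw [norm_projection_line, angle, pow_mul]
  simp only [hang]
  rw [sphereMeasure, integral_smul_measure, h, hK, finrank_vec, ENNReal.toReal_inv, smul_eq_mul,
    ← measureReal_def, inv_mul_cancel_left₀ hpos, Nat.cast_mul]

instance [NeZero d] : IsProbabilityMeasure (sphereMeasure 𝕜 d) := by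
  have : Nontrivial (Vec 𝕜 d) := Module.nontrivial_of_finrank_pos (R := ℝ) <| by
    rw [finrank_vec]
    exact Nat.mul_pos Module.finrank_pos (NeZero.pos d)
  refine ⟨?_⟩
  rw [sphereMeasure, Measure.smul_apply, smul_eq_mul]
  exact ENNReal.inv_mul_cancel (Measure.measure_univ_ne_zero.mpr (Measure.toSphere_ne_zero _))
    (measure_ne_top _ _)

variable [ContinuousStar 𝕜]

lemma continuous_angle : Continuous fun p : Metric.sphere (0 : Vec 𝕜 d) 1 ×
    Metric.sphere (0 : Vec 𝕜 d) 1 => angle (p.1 : Vec 𝕜 d) (p.2 : Vec 𝕜 d) := by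
  unfold angle ip
  fun_prop

instance [NeZero d] : IsProbabilityMeasure (angleMeasure 𝕜 d) :=
  Measure.isProbabilityMeasure_map continuous_angle.aemeasurable

lemma memLp_eval_angleMeasure [NeZero d] (p : ℝ[X]) :
    MemLp (fun s => p.eval s) 2 (angleMeasure 𝕜 d) := by
  have hp : Continuous fun s => p.eval s := p.continuous
  rw [angleMeasure, memLp_map_measure_iff hp.aestronglyMeasurable continuous_angle.aemeasurable]
  have hc := hp.comp (continuous_angle (𝕜 := 𝕜) (d := d))
  obtain ⟨C, hC⟩ := isCompact_univ.exists_bound_of_continuousOn hc.continuousOn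
  exact MemLp.of_bound hc.aestronglyMeasurable C
    (Filter.Eventually.of_forall fun x => hC x (Set.mem_univ x))

lemma integral_pow_angleMeasure [NeZero d] (k : ℕ) :
    ∫ s, s ^ k ∂(angleMeasure 𝕜 d) =
      (ascPochhammer ℝ k).eval (Module.finrank ℝ 𝕜 / 2 : ℝ) /
        (ascPochhammer ℝ k).eval (Module.finrank ℝ 𝕜 * d / 2 : ℝ) := by
  have hc : Continuous fun s : ℝ => s ^ k := continuous_pow k
  have hint : Integrable (fun p : Metric.sphere (0 : Vec 𝕜 d) 1 × Metric.sphere (0 : Vec 𝕜 d) 1 =>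
      angle (p.1 : Vec 𝕜 d) (p.2 : Vec 𝕜 d) ^ k) ((sphereMeasure 𝕜 d).prod (sphereMeasure 𝕜 d)) := by
    exact (continuous_angle.pow k).integrable_of_hasCompactSupport
      (HasCompactSupport.of_compactSpace _)
  rw [angleMeasure, integral_map continuous_angle.aemeasurable hc.aestronglyMeasurable,
    integral_prod _ hint]
  have h : ∀ x : Metric.sphere (0 : Vec 𝕜 d) 1, ‖(x : Vec 𝕜 d)‖ = 1 := norm_eq_of_mem_sphere
  simp [integral_angle_pow _ (h _)]

/-- Designs are characterised by the moments of their angles. -/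
lemma isProjectiveDesign_iff_sum_pow [NeZero d] {n : ℕ} (v : Fin n → Vec 𝕜 d) (t : ℕ) :
    IsProjectiveDesign t v ↔ ∀ k ≤ t, ∑ i, ∑ j, angle (v i) (v j) ^ k =
      (n : ℝ) ^ 2 * ∫ s, s ^ k ∂(angleMeasure 𝕜 d) := by
  have hint : ∀ p : ℝ[X], Integrable (fun s => p.eval s) (angleMeasure 𝕜 d) := fun p =>
    (memLp_eval_angleMeasure p).integrable one_le_two
  constructor
  · intro h
    suffices H : ∀ k ≤ t, ∀ p : ℝ[X], p.degree ≤ k → ∑ i, ∑ j, p.eval (angle (v i) (v j)) =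
        (n : ℝ) ^ 2 * ∫ s, p.eval s ∂(angleMeasure 𝕜 d) by
      intro k hk
      simpa using H k hk (X ^ k) (degree_X_pow_le k)
    intro k
    induction k with
    | zero =>
      intro _ p hp
      rw [eq_C_of_degree_le_zero hp]
      simp
      ring
    | succ k ih =>
      intro hk p hp
      obtain ⟨Q, hQ⟩ := exists_isOrthogonalPolynomial
        (memLp_eval_angleMeasure (𝕜 := 𝕜) (d := d)) (k + 1)
      have hQ0 : Q ≠ 0 := fun h0 => by
        have h1 := hQ.1
        rw [h0, degree_zero] at h1
        exact WithBot.bot_ne_coe h1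
      have hsum := h (k + 1) (Finset.mem_Icc.mpr ⟨by omega, hk⟩) Q hQ
      have hQint : ∫ s, Q.eval s ∂(angleMeasure 𝕜 d) = 0 := by
        simpa using hQ.2 1 (by rw [degree_one]; exact_mod_cast Nat.succ_pos k)
      -- Cancelling the top coefficient of `p` with a multiple of `Q` lowers the degree.
      obtain ⟨r, q, hq, rfl⟩ : ∃ (r : ℝ) (q : ℝ[X]), q.degree ≤ k ∧ p = r • Q + q := by
        refine ⟨p.coeff (k + 1) / Q.coeff (k + 1), _, ?_, (add_sub_cancel _ p).symm⟩
        have hlc : Q.coeff (k + 1) ≠ 0 := by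
          rw [← natDegree_eq_of_degree_eq_some hQ.1]
          exact leadingCoeff_ne_zero.mpr hQ0
        rw [degree_le_iff_coeff_zero]
        intro m hm
        have hm' : k + 1 ≤ m := by exact_mod_cast hm
        rcases hm'.eq_or_lt with rfl | hlt
        · simp [hlc]
        · have hlt' : ((k + 1 : ℕ) : WithBot ℕ) < m := by exact_mod_cast hlt
          rw [coeff_sub, coeff_smul, coeff_eq_zero_of_degree_lt (hp.trans_lt hlt'),
            coeff_eq_zero_of_degree_lt (hQ.1.trans_lt hlt')]
          simp
      simp only [eval_add, eval_smul, smul_eq_mul, Finset.sum_add_distrib, ← Finset.mul_sum, hsum]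
      rw [integral_add ((hint Q).const_mul r) (hint q), integral_const_mul, hQint,
        ih (by omega) q hq]
      ring
  · intro h k hk Q hQ
    obtain ⟨hk1, hkt⟩ := Finset.mem_Icc.mp hk
    have hQint : ∫ s, Q.eval s ∂(angleMeasure 𝕜 d) = 0 := by
      simpa using hQ.2 1 (by rw [degree_one]; exact_mod_cast hk1)
    have hpow : ∀ m, Integrable (fun s : ℝ => s ^ m) (angleMeasure 𝕜 d) := fun m => by
      simpa using hint (X ^ m)
    have hdeg := natDegree_eq_of_degree_eq_some hQ.1
    simp only [eval_eq_sum_range] at hQint ⊢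
    rw [integral_finsetSum _ fun m _ => (hpow m).const_mul _] at hQint
    simp only [integral_const_mul] at hQint
    calc _ = ∑ m ∈ Finset.range (Q.natDegree + 1),
          Q.coeff m * ∑ i, ∑ j, angle (v i) (v j) ^ m := by
          simp only [Finset.mul_sum]
          rw [Finset.sum_comm]
          rw [Finset.sum_congr rfl fun j _ => Finset.sum_comm]
          rw [Finset.sum_comm]
          exact Finset.sum_congr rfl fun m _ => Finset.sum_comm
      _ = ∑ m ∈ Finset.range (Q.natDegree + 1),
          (n : ℝ) ^ 2 * (Q.coeff m * ∫ s, s ^ m ∂(angleMeasure 𝕜 d)) := by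
          refine Finset.sum_congr rfl fun m hm => ?_
          rw [h m (by have := Finset.mem_range.mp hm; omega)]
          ring
      _ = 0 := by rw [← Finset.mul_sum, hQint, mul_zero]

/-- A system of unit vectors is a design as soon as the highest moment is the right one. -/
lemma isProjectiveDesign_iff [NeZero d] {n : ℕ} (v : Fin n → Vec 𝕜 d) (hv : ∀ i, ‖v i‖ = 1)
    (t : ℕ) :
    IsProjectiveDesign t v ↔ ∑ i, ∑ j, angle (v i) (v j) ^ t =
      (n : ℝ) ^ 2 * ((ascPochhammer ℝ t).eval (Module.finrank ℝ 𝕜 / 2 : ℝ) /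
        (ascPochhammer ℝ t).eval (Module.finrank ℝ 𝕜 * d / 2 : ℝ)) := by
  rw [isProjectiveDesign_iff_sum_pow]
  simp only [integral_pow_angleMeasure]
  refine ⟨fun h => h t le_rfl, fun h k hk => ?_⟩
  obtain ⟨w, hw⟩ := exists_sum_mul_feature (𝕜 := 𝕜) (d := d)
  have key := sum_kernel_pow_eq_of_le (X := Metric.sphere (0 : Vec 𝕜 d) 1)
    (σ := sphereMeasure 𝕜 d) (φ := fun x => feature (x : Vec 𝕜 d))
    (c := fun k => (ascPochhammer ℝ k).eval (Module.finrank ℝ 𝕜 / 2 : ℝ) /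
        (ascPochhammer ℝ k).eval (Module.finrank ℝ 𝕜 * d / 2 : ℝ))
    (fun t J => (continuous_finsetProd _ fun k _ =>
      (continuous_feature (J k)).comp continuous_subtype_val).integrable_of_hasCompactSupport
        (HasCompactSupport.of_compactSpace _))
    (fun x k => by
      simp only [sum_feature_mul_feature]
      exact integral_angle_pow _ (norm_eq_of_mem_sphere x) k)
    w (fun x => by rw [hw, norm_eq_of_mem_sphere, one_pow])
    (fun i => (⟨v i, by simp [hv]⟩ : Metric.sphere (0 : Vec 𝕜 d) 1)) (t := t)
  simp only [sum_feature_mul_feature, Fintype.card_fin] at key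
  exact key h hk

lemma sum_offDiag_angle_pow {n : ℕ} {v : Fin n → Vec 𝕜 d} {δ : ℝ → ℕ} (h : IsRegularScheme v δ)
    (t : ℕ) (i : Fin n) :
    ∑ j ∈ Finset.univ.erase i, angle (v i) (v j) ^ t = ∑ α ∈ angles v, α ^ t * (δ α : ℝ) := by
  classical
  rw [← Finset.sum_fiberwise_of_maps_to (t := angles v) (g := fun j => angle (v i) (v j))]
  · refine Finset.sum_congr rfl fun α hα => ?_
    rw [← h.valency_eq α hα i, Finset.sum_congr rfl
      (fun j hj => by rw [(Finset.mem_filter.mp hj).2] :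
        ∀ j ∈ _, angle (v i) (v j) ^ t = α ^ t), Finset.sum_const, nsmul_eq_mul, mul_comm,
      valencyAt]
    congr 3
    ext j
    simp
  · intro j hj
    exact Finset.mem_image.mpr ⟨(i, j), by simpa [eq_comm] using hj, rfl⟩

/-- A regular scheme is a design if and only if the highest moment of its angles is the right
one. -/
theorem IsRegularScheme.isProjectiveDesign_iff {n : ℕ} (hn : 1 ≤ n) {v : Fin n → Vec 𝕜 d}
    {δ : ℝ → ℕ} (h : IsRegularScheme v δ) (t : ℕ) :
    IsProjectiveDesign t v ↔ 1 + ∑ α ∈ angles v, α ^ t * (δ α : ℝ) =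
      n * ((ascPochhammer ℝ t).eval (Module.finrank ℝ 𝕜 / 2 : ℝ) /
        (ascPochhammer ℝ t).eval (Module.finrank ℝ 𝕜 * d / 2 : ℝ)) := by
  -- The zero space has no unit vector, so one point already forces `d ≥ 1`.
  have : NeZero d := ⟨by
    rintro rfl
    have := h.norm_eq_one ⟨0, hn⟩
    rw [Subsingleton.elim (v ⟨0, hn⟩) 0, norm_zero] at this
    exact zero_ne_one this⟩
  rw [ProjDesign.isProjectiveDesign_iff v h.norm_eq_one]
  have hs : ∀ i, ∑ j, angle (v i) (v j) ^ t = 1 + ∑ α ∈ angles v, α ^ t * (δ α : ℝ) := fun i => by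
    rw [← sum_offDiag_angle_pow h t i, ← Finset.add_sum_erase _ _ (Finset.mem_univ i),
      angle_self _ (h.norm_eq_one i), one_pow]
  simp only [hs, Finset.sum_const, Finset.card_univ, Fintype.card_fin, nsmul_eq_mul]
  rw [sq, mul_assoc, mul_right_inj' (by exact_mod_cast (by omega : n ≠ 0))]

end Generic

end ProjDesign

end

theorem mainTheorem9 (d n t : ℕ) (hn : 1 ≤ n) (ht : 1 ≤ t) :
    (∀ (v : Fin n → ProjDesign.Vec ℝ d) (δ : ℝ → ℕ), ProjDesign.IsRegularScheme v δ →
      (ProjDesign.IsProjectiveDesign t v ↔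
        1 + ∑ α ∈ ProjDesign.angles v, α ^ t * (δ α : ℝ) =
          n * ((ascPochhammer ℝ t).eval (1 / 2 : ℝ) / (ascPochhammer ℝ t).eval (1 * d / 2 : ℝ)))) ∧
    (∀ (v : Fin n → ProjDesign.Vec ℂ d) (δ : ℝ → ℕ), ProjDesign.IsRegularScheme v δ →
      (ProjDesign.IsProjectiveDesign t v ↔
        1 + ∑ α ∈ ProjDesign.angles v, α ^ t * (δ α : ℝ) =
          n * ((ascPochhammer ℝ t).eval (2 / 2 : ℝ) / (ascPochhammer ℝ t).eval (2 * d / 2 : ℝ)))) ∧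
    (∀ (v : Fin n → ProjDesign.Vec ℍ[ℝ] d) (δ : ℝ → ℕ), ProjDesign.IsRegularScheme v δ →
      (ProjDesign.IsProjectiveDesign t v ↔
        1 + ∑ α ∈ ProjDesign.angles v, α ^ t * (δ α : ℝ) =
          n * ((ascPochhammer ℝ t).eval (4 / 2 : ℝ) / (ascPochhammer ℝ t).eval (4 * d / 2 : ℝ)))) := by
  refine ⟨fun v δ h => ?_, fun v δ h => ?_, fun v δ h => ?_⟩
  · have := h.isProjectiveDesign_iff hn t
    rwa [Module.finrank_self, Nat.cast_one] at this
  · have := h.isProjectiveDesign_iff hn t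
    rwa [Complex.finrank_real_complex, Nat.cast_ofNat] at this
  · have := h.isProjectiveDesign_iff hn t
    rwa [Quaternion.finrank_eq_four, Nat.cast_ofNat] at this
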